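/- Let $p>3$ be a prime, let $\mathbb Z_p$ denote the set of rational numbers whose denominator is not divisible by $p$, and for rational numbers $u,v$ write $u\equiv v \pmod p$ if $u-v=pc$ for some $c\in\mathbb Z_p$. Let $a_1,a_2,a_3\in\mathbb Z_p$, put $$P=-2a_1^3+9a_1a_2-27a_3,\qquad Q=(a_1^2-3a_2)^3,$$ and assume that $PQ(P^2-Q)(P^2-3Q)(P^2-4Q)\not\equiv 0\pmod p$. Let $N$ be the number of solutions modulo $p$ of the congruence $x^3+a_1x^2+a_2x+a_3\equiv 0\pmod p$, that is, the number of $x\in\{0,1,\ldots,p-1\}$ satisfying it. Let $\lfloor p/3\rfloor$ be the greatest integer not exceeding $p/3$. Then: (i) $N=3$ if and only if $$\sum_{k=1}^{\lfloor p/3\rfloor}\binom{3k}{k}\left(\frac{4Q-P^2}{27Q}\right)^k\equiv 0\pmod p;$$ (ii) $N=1$ if and only if the number $$x_0=\frac{P}{3(a_1^2-3a_2)}\sum_{k=0}^{\lfloor p/3\rfloor}\binom{3k}{k}\left(\frac{4Q-P^2}{27Q}\right)^k-\frac{a_1}{3}$$ satisfies $x_0^3+a_1x_0^2+a_2x_0+a_3\equiv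 0\pmod p$. -/

import Mathlib

/-- The rational numbers whose denominator (in lowest terms) is not divisible by `p`. -/
def pIntegralRat (p : ℕ) : Set ℚ :=
  {a | ¬ p ∣ a.den}

/-- Congruence modulo `p` of rational numbers: the difference is `p` times a rational number
whose denominator is not divisible by `p`. -/
def RatModEq (p : ℕ) (a b : ℚ) : Prop :=
  ∃ c ∈ pIntegralRat p, a - b = (p : ℚ) * c

open Classical in
/-- The number of solutions `x` modulo `p` of the congruence `f x ≡ 0 (mod p)`, counted over the
complete residue system `0, 1, …, p - 1`. -/
noncomputable def numSolutionsMod (p : ℕ) (f : Polynomial ℚ) : ℕ :=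
  ((Finset.range p).filter fun x : ℕ => RatModEq p (f.eval (x : ℚ)) 0).card

/-- The monic cubic `x³ + a₁ x² + a₂ x + a₃`. -/
noncomputable def monicCubic (a₁ a₂ a₃ : ℚ) : Polynomial ℚ :=
  Polynomial.X ^ 3 + Polynomial.C a₁ * Polynomial.X ^ 2 + Polynomial.C a₂ * Polynomial.X
    + Polynomial.C a₃

open Finset

/-! ### A pair of binomial sums -/

/-! Reduce mod `p` and put `A = a₁² - 3a₂`, `c = P²/Q`. Substituting `x = (P/(3A)) z - a₁/3` gives
`c z³ = 3z + 1`, and `q = 1 + z⁻¹` gives `q³ - 3q = c - 2`. Over an algebraic closure write `c - 2 =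
v + v⁻¹`; the roots are `q = x + x⁻¹` with `x³ = v`.

With `n = ⌊p/3⌋`, `C(3k,k) ≡ (-27)^k C(n+k,2k)`, so the sum `S` from `k = 0` is `∑ C(n+k,2k)
(c-4)^k`, which has a closed form in `v`. Taking `m = ±p ≡ 1 (mod 3)` and `b³ = v`, it becomes `S
(v+1) = b^(m+2) + b^(1-m)`: the Frobenius action on cube roots of `v`, which decides which roots are
rational, also determines `S`.

If `v^m = v`, then `b^m = w b` with `w³ = 1`: either `w = 1`, `N = 3` and `S = 1`, or `N = 0`. If
`v^m = v⁻¹`, exactly one root `q` is rational and `S = 1/(q-1)` is the corresponding `z`. This is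
`card_roots_trichotomy`. -/

theorem choose_sum_recurrence {R : Type*} [CommRing R] (X : R) (n : ℕ) :
    ∑ k ∈ range (n + 2), ((n + 1 + k).choose (2 * k) : R) * X ^ k =
      ∑ k ∈ range (n + 1), ((n + k).choose (2 * k) : R) * X ^ k +
        X * ∑ k ∈ range (n + 1), ((n + k + 1).choose (2 * k + 1) : R) * X ^ k := by
  have key : ∀ k, ((n + 1 + (k + 1)).choose (2 * (k + 1)) : R) =
      ((n + (k + 1)).choose (2 * (k + 1)) : R) + ((n + k + 1).choose (2 * k + 1) : R) := by
    intro k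
    have : n + 1 + (k + 1) = (n + k + 1) + 1 := by ring
    rw [this, show 2 * (k + 1) = (2 * k + 1) + 1 by ring, Nat.choose_succ_succ]
    push_cast
    rw [show n + (k + 1) = n + k + 1 by ring]
    ring
  have top : ((n + (n + 1)).choose (2 * (n + 1)) : R) = 0 := by
    rw [Nat.choose_eq_zero_of_lt (by omega)]; simp
  have hpad : ∑ k ∈ range (n + 1), ((n + k).choose (2 * k) : R) * X ^ k =
      ∑ k ∈ range (n + 2), ((n + k).choose (2 * k) : R) * X ^ k := by
    rw [sum_range_succ _ (n + 1), top]; simp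
  rw [hpad, sum_range_succ' _ (n + 1), sum_range_succ' _ (n + 1), mul_sum]
  simp only [key, add_mul, sum_add_distrib]
  have : ∀ k, X * (((n + k + 1).choose (2 * k + 1) : R) * X ^ k) =
      ((n + k + 1).choose (2 * k + 1) : R) * X ^ (k + 1) := fun k => by ring
  simp only [this]
  simp
  ring

theorem choose_odd_sum_recurrence {R : Type*} [CommRing R] (X : R) (n : ℕ) :
    ∑ k ∈ range (n + 2), ((n + 1 + k + 1).choose (2 * k + 1) : R) * X ^ k =
      ∑ k ∈ range (n + 1), ((n + k + 1).choose (2 * k + 1) : R) * X ^ k +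
        ∑ k ∈ range (n + 2), ((n + 1 + k).choose (2 * k) : R) * X ^ k := by
  have key : ∀ k, ((n + 1 + k + 1).choose (2 * k + 1) : R) =
      ((n + k + 1).choose (2 * k + 1) : R) + ((n + 1 + k).choose (2 * k) : R) := by
    intro k
    rw [Nat.choose_succ_succ, show n + 1 + k = n + k + 1 by ring]
    push_cast
    ring
  have top : ((n + (n + 1) + 1).choose (2 * (n + 1) + 1) : R) = 0 := by
    rw [Nat.choose_eq_zero_of_lt (by omega)]; simp
  have hpad : ∑ k ∈ range (n + 1), ((n + k + 1).choose (2 * k + 1) : R) * X ^ k =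
      ∑ k ∈ range (n + 2), ((n + k + 1).choose (2 * k + 1) : R) * X ^ k := by
    rw [sum_range_succ _ (n + 1), top]; simp
  rw [hpad, ← sum_add_distrib]
  exact sum_congr rfl fun k _ => by rw [key]; ring

/-- Closed form of `∑ C(n+k,2k) X^k` (and of its companion) at `X = v - 2 + v⁻¹`. -/
theorem choose_sum_closed_form {K : Type*} [Field K] {X v : K} (hv : v * X = (v - 1) ^ 2) (n : ℕ) :
    (∑ k ∈ range (n + 1), ((n + k).choose (2 * k) : K) * X ^ k) * ((v + 1) * v ^ n) =
        v ^ (2 * n + 1) + 1 ∧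
      (∑ k ∈ range (n + 1), ((n + k + 1).choose (2 * k + 1) : K) * X ^ k) *
        ((v ^ 2 - 1) * v ^ n) = v ^ (2 * n + 2) - 1 := by
  induction n with
  | zero => constructor <;> simp
  | succ n ih =>
    obtain ⟨h1, h2⟩ := ih
    have h3 := choose_sum_recurrence X n
    have h4 := choose_odd_sum_recurrence X n
    set T := ∑ k ∈ range (n + 1), ((n + k).choose (2 * k) : K) * X ^ k
    set U := ∑ k ∈ range (n + 1), ((n + k + 1).choose (2 * k + 1) : K) * X ^ k
    have h5 : (T + X * U) * ((v + 1) * v ^ (n + 1)) = v ^ (2 * (n + 1) + 1) + 1 := by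
      linear_combination v * h1 + (v - 1) * h2 + U * (v + 1) * v ^ n * hv
    rw [h4, h3]
    refine ⟨h5, ?_⟩
    linear_combination v * h2 + (v - 1) * h5

/-! ### Binomial coefficients `C(3k, k)` modulo `p` -/

theorem choose_three_mul_succ (k : ℕ) :
    (3 * (k + 1)).choose (k + 1) * ((2 * k + 2) * (2 * k + 1)) =
      (3 * k).choose k * (3 * (3 * k + 1) * (3 * k + 2)) := by
  have e1 := Nat.choose_mul_factorial_mul_factorial (show k ≤ 3 * k by omega)
  have e2 := Nat.choose_mul_factorial_mul_factorial (show k + 1 ≤ 3 * (k + 1) by omega)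
  rw [show 3 * k - k = 2 * k by omega] at e1
  rw [show 3 * (k + 1) - (k + 1) = 2 * k + 1 + 1 by omega,
    show 3 * (k + 1) = 3 * k + 1 + 1 + 1 by ring] at e2
  simp only [Nat.factorial_succ] at e2
  rw [show 3 * k + 1 + 1 + 1 = 3 * (k + 1) by ring] at e2
  have hpos : 0 < (k + 1) * k.factorial * (2 * k).factorial := by positivity
  apply Nat.eq_of_mul_eq_mul_right hpos
  rw [← e1] at e2
  linear_combination e2

theorem choose_add_two_mul_succ {n k : ℕ} (hk : k < n) :
    (n + (k + 1)).choose (2 * (k + 1)) * ((2 * k + 2) * (2 * k + 1)) =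
      (n + k).choose (2 * k) * ((n + k + 1) * (n - k)) := by
  obtain ⟨d, rfl⟩ := Nat.exists_eq_add_of_lt hk
  have e1 := Nat.choose_mul_factorial_mul_factorial (show 2 * k ≤ k + d + 1 + k by omega)
  have e2 := Nat.choose_mul_factorial_mul_factorial
    (show 2 * (k + 1) ≤ k + d + 1 + (k + 1) by omega)
  rw [show k + d + 1 + k - 2 * k = d + 1 by omega] at e1
  rw [show k + d + 1 + (k + 1) - 2 * (k + 1) = d by omega] at e2
  rw [show k + d + 1 + (k + 1) = k + d + 1 + k + 1 by ring,
    show 2 * (k + 1) = 2 * k + 1 + 1 by ring] at e2 ⊢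
  simp only [Nat.factorial_succ (k + d + 1 + k), Nat.factorial_succ (2 * k + 1),
    Nat.factorial_succ (2 * k)] at e2
  rw [Nat.factorial_succ d] at e1
  rw [show k + d + 1 - k = d + 1 by omega]
  have hpos : 0 < (2 * k).factorial * d.factorial := by positivity
  apply Nat.eq_of_mul_eq_mul_right hpos
  rw [← e1] at e2
  linear_combination e2

/-- Both sides have the same ratio of consecutive terms: `9n(n+1) = -2` turns `-27(n+k+1)(n-k)` into
`3(3k+1)(3k+2)`. -/
theorem choose_three_mul_zmod {p : ℕ} [Fact p.Prime] (hp3 : 3 < p) {k : ℕ} (hk : k ≤ p / 3) :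
    ((3 * k).choose k : ZMod p) = (-27) ^ k * ((p / 3 + k).choose (2 * k) : ZMod p) := by
  have hp : p.Prime := Fact.out
  induction k with
  | zero => simp
  | succ k ih =>
    specialize ih (by omega)
    have e1 := congrArg (Nat.cast : ℕ → ZMod p) (choose_three_mul_succ k)
    have e2 := congrArg (Nat.cast : ℕ → ZMod p)
      (choose_add_two_mul_succ (n := p / 3) (k := k) (by omega))
    have hne : (((2 * k + 2) * (2 * k + 1) : ℕ) : ZMod p) ≠ 0 := by
      rw [Ne, ZMod.natCast_eq_zero_iff, hp.dvd_mul]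
      rintro (h | h) <;> have := Nat.le_of_dvd (by omega) h <;> omega
    -- Equivalent to `(3n+1)(3n+2) = 0`; one of the two factors equals `p`.
    have hn : 9 * ((p / 3 : ℕ) : ZMod p) * (((p / 3 : ℕ) : ZMod p) + 1) = -2 := by
      have h3 : p % 3 = 1 ∨ p % 3 = 2 := by
        have : p % 3 ≠ 0 := fun h =>
          absurd ((Nat.prime_dvd_prime_iff_eq Nat.prime_three hp).1 (Nat.dvd_of_mod_eq_zero h))
            (by omega)
        omega
      have hz : (p : ZMod p) = 0 := ZMod.natCast_self p
      generalize hn' : p / 3 = n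
      rcases h3 with h3 | h3
      · have h := congrArg (Nat.cast : ℕ → ZMod p) (show 3 * n + 1 = p by omega)
        push_cast at h
        rw [hz] at h
        linear_combination (3 * (n : ZMod p) + 2) * h
      · have h := congrArg (Nat.cast : ℕ → ZMod p) (show 3 * n + 2 = p by omega)
        push_cast at h
        rw [hz] at h
        linear_combination (3 * (n : ZMod p) + 1) * h
    apply mul_right_cancel₀ hne
    rw [Nat.cast_mul, Nat.cast_mul ((3 * k).choose k), ih] at e1
    rw [Nat.cast_mul, Nat.cast_mul ((p / 3 + k).choose _), Nat.cast_mul _ (p / 3 - k), Nat.cast_sub (by omega)] at e2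
    rw [e1, mul_assoc (_ ^ (k + 1)), e2]
    push_cast
    linear_combination 3 * (-27) ^ k * ((p / 3 + k).choose (2 * k) : ZMod p) * hn

theorem sum_choose_three_mul_zmod {p : ℕ} [Fact p.Prime] (hp3 : 3 < p) (t : ZMod p) :
    ∑ k ∈ range (p / 3 + 1), ((3 * k).choose k : ZMod p) * t ^ k =
      ∑ k ∈ range (p / 3 + 1), ((p / 3 + k).choose (2 * k) : ZMod p) * (-27 * t) ^ k := by
  refine sum_congr rfl fun k hk => ?_
  rw [choose_three_mul_zmod hp3 (by simpa [Nat.lt_succ_iff] using hk), mul_pow]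
  ring

/-! ### The cubic `q³ - 3q = v + v⁻¹` through `q = x + x⁻¹`, `x³ = v` -/

theorem mem_range_zmod_iff {p : ℕ} [Fact p.Prime] {K : Type*} [Field K]
    (ι : ZMod p →+* K) (x : K) : (∃ q : ZMod p, ι q = x) ↔ x ^ p = x := by
  have : CharP K p := charP_of_injective_ringHom ι.injective p
  rw [← Subfield.mem_bot_iff_pow_eq_self K p, ← ZMod.fieldRange_castHom_eq_bot p,
    RingHom.mem_fieldRange, Subsingleton.elim (ZMod.castHom (dvd_refl p) K) ι]

theorem add_inv_eq_add_inv_iff {K : Type*} [Field K] {x y : K} (hx : x ≠ 0) (hy : y ≠ 0) :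
    x + x⁻¹ = y + y⁻¹ ↔ x = y ∨ x * y = 1 := by
  have h : x + x⁻¹ - (y + y⁻¹) = (x - y) * (x * y - 1) / (x * y) := by
    field_simp
    ring
  rw [← sub_eq_zero, h, div_eq_zero_iff, mul_eq_zero, sub_eq_zero, sub_eq_zero]
  simp [hx, hy]

/-- Lying in the prime field means being fixed by Frobenius, and `x^m + x^(-m)` does not see the
sign of `m`. This leaves the sign free to arrange `m ≡ 1 (mod 3)`. -/
theorem add_inv_mem_range_iff {p : ℕ} [Fact p.Prime] {K : Type*} [Field K]
    (ι : ZMod p →+* K) {m : ℤ} (hm : m = p ∨ m = -p) {x : K} (hx : x ≠ 0) :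
    (∃ q : ZMod p, ι q = x + x⁻¹) ↔ x ^ m = x ∨ x ^ m * x = 1 := by
  have : CharP K p := charP_of_injective_ringHom ι.injective p
  have h : (x + x⁻¹) ^ p = x ^ m + (x ^ m)⁻¹ := by
    rw [add_pow_char]
    rcases hm with rfl | rfl
    · simp
    · simp [add_comm]
  rw [mem_range_zmod_iff, h, add_inv_eq_add_inv_iff (zpow_ne_zero _ hx) hx]

theorem zpow_eq_self_of_pow_three_eq_one {K : Type*} [Field K] {m : ℤ} (hm : m % 3 = 1) {w : K}
    (hw : w ^ 3 = 1) : w ^ m = w := by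
  have hw0 : w ≠ 0 := by rintro rfl; simp at hw
  obtain ⟨j, rfl⟩ : ∃ j, m = 3 * j + 1 := ⟨m / 3, by omega⟩
  rw [zpow_add₀ hw0, zpow_mul, zpow_one]
  have : w ^ (3 : ℤ) = 1 := by exact_mod_cast hw
  simp [this]

theorem prime_eq_three_mul_div_add {p : ℕ} (hp : p.Prime) (hp3 : 3 < p) :
    (p = 3 * (p / 3) + 1) ∨ (p = 3 * (p / 3) + 2) := by
  have : p % 3 ≠ 0 := fun h =>
    absurd ((Nat.prime_dvd_prime_iff_eq Nat.prime_three hp).1 (Nat.dvd_of_mod_eq_zero h)) (by omega)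
  omega

theorem exists_add_inv_eq {K : Type*} [Field K] [IsAlgClosed K] (d : K) :
    ∃ v : K, v ≠ 0 ∧ v + v⁻¹ = d := by
  have hdeg : (Polynomial.X ^ 2 - Polynomial.C d * Polynomial.X + 1 : Polynomial K).degree = 2 := by
    compute_degree!
  obtain ⟨x, hx⟩ := IsAlgClosed.exists_root
    (Polynomial.X ^ 2 - Polynomial.C d * Polynomial.X + 1 : Polynomial K) (by rw [hdeg]; norm_num)
  simp only [Polynomial.IsRoot.def, Polynomial.eval_add, Polynomial.eval_sub,
    Polynomial.eval_pow, Polynomial.eval_mul, Polynomial.eval_C, Polynomial.eval_X,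
    Polynomial.eval_one] at hx
  have hx0 : x ≠ 0 := by rintro rfl; simp at hx
  exact ⟨x, hx0, by field_simp; linear_combination hx⟩

theorem depressed_cubic_iff {K : Type*} [Field K] [IsAlgClosed K] {v q : K} (hv : v ≠ 0) :
    q ^ 3 - 3 * q = v + v⁻¹ ↔ ∃ x, x ^ 3 = v ∧ x + x⁻¹ = q := by
  have expand : ∀ x : K, x ≠ 0 → (x + x⁻¹) ^ 3 - 3 * (x + x⁻¹) = x ^ 3 + (x ^ 3)⁻¹ := by
    intro x hx
    field_simp
    ring
  constructor
  · intro h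
    obtain ⟨x, hx0, hq⟩ := exists_add_inv_eq q
    rw [← hq, expand x hx0, add_inv_eq_add_inv_iff (pow_ne_zero 3 hx0) hv] at h
    rcases h with h | h
    · exact ⟨x, h, hq⟩
    · refine ⟨x⁻¹, ?_, by rw [inv_inv, add_comm, hq]⟩
      rw [inv_pow]
      exact inv_eq_of_mul_eq_one_right h
  · rintro ⟨x, rfl, rfl⟩
    exact expand x (by rintro rfl; simp at hv)

/-- The closed form reads `v^(n+1) + v^(-n)` with `v = b³`. These terms are `b^(m+2)` and `b^(1-m)`
when `p = 3n+1`, and swap when `p = 3n+2`, so one formula serves both cases. -/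
theorem choose_sum_mul_zpow {p : ℕ} {K : Type*} [Field K] {X b : K} (hb : b ≠ 0)
    (hX : b ^ 3 * X = (b ^ 3 - 1) ^ 2) {m : ℤ}
    (hm : m = p ∧ p = 3 * (p / 3) + 1 ∨ m = -p ∧ p = 3 * (p / 3) + 2) :
    (∑ k ∈ range (p / 3 + 1), ((p / 3 + k).choose (2 * k) : K) * X ^ k) * (b ^ 3 + 1) * b ^ m =
      b * ((b ^ m) ^ 2 * b + 1) := by
  have h := (choose_sum_closed_form hX (p / 3)).1
  generalize p / 3 = n at h hm ⊢
  set S := ∑ k ∈ range (n + 1), ((n + k).choose (2 * k) : K) * X ^ k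
  rcases hm with ⟨rfl, rfl⟩ | ⟨rfl, rfl⟩
  · rw [zpow_natCast]
    linear_combination b * h
  · have e : (b ^ (3 * n + 2))⁻¹ * b ^ (3 * n + 2) = 1 := inv_mul_cancel₀ (pow_ne_zero _ hb)
    rw [zpow_neg, zpow_natCast]
    set a := (b ^ (3 * n + 2))⁻¹
    linear_combination a ^ 2 * b ^ 2 * h - S * (b ^ 3 + 1) * a * e +
      b * (a * b ^ (3 * n + 2) + 1) * e

/-- The roots in `ZMod p` of `q³ - 3q = c - 2` against the value of the binomial sum at `c - 4`. -/
theorem card_roots_trichotomy {p : ℕ} [Fact p.Prime] (hp3 : 3 < p) {c S : ZMod p} (hc0 : c ≠ 0)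
    (hc1 : c ≠ 1) (hc4 : c ≠ 4)
    (hS : S = ∑ k ∈ range (p / 3 + 1), ((p / 3 + k).choose (2 * k) : ZMod p) * (c - 4) ^ k) :
    (#{q : ZMod p | q ^ 3 - 3 * q = c - 2} = 1 ∧ S ≠ 1 ∧ c * S ^ 3 = 3 * S + 1) ∨
    (#{q : ZMod p | q ^ 3 - 3 * q = c - 2} = 3 ∧ S = 1 ∧ c * S ^ 3 ≠ 3 * S + 1) ∨
    (#{q : ZMod p | q ^ 3 - 3 * q = c - 2} = 0 ∧ S ≠ 1 ∧ c * S ^ 3 ≠ 3 * S + 1) := by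
  have hp : p.Prime := Fact.out
  obtain ⟨K, _, _, ⟨ι⟩⟩ : ∃ (K : Type) (_ : Field K) (_ : IsAlgClosed K), Nonempty (ZMod p →+* K) :=
    ⟨AlgebraicClosure (ZMod p), inferInstance, inferInstance, ⟨algebraMap _ _⟩⟩
  have hι : Function.Injective ι := ι.injective
  have h3K : (3 : K) ≠ 0 := by
    have h : (3 : ZMod p) ≠ 0 := by
      have : ((3 : ℕ) : ZMod p) ≠ 0 := by
        rw [Ne, ZMod.natCast_eq_zero_iff]
        exact fun h => absurd (Nat.le_of_dvd (by omega) h) (by omega)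
      exact_mod_cast this
    intro h'
    exact h (hι (by rw [map_ofNat, map_zero, h']))
  obtain ⟨v, hv0, hv⟩ := exists_add_inv_eq (ι c - 2)
  have hvc : v ^ 2 + 1 = (ι c - 2) * v := by
    rw [← hv]; field_simp
  -- The excluded values `c = 4, 0, 1` correspond to `v = 1`, `v = -1` and `v` a root of `v² + v +
  -- 1`.
  have hv1 : v - 1 ≠ 0 := by
    intro h
    rw [sub_eq_zero.1 h] at hvc
    exact hc4 (hι (by rw [map_ofNat]; linear_combination -hvc))
  have hvn1 : v + 1 ≠ 0 := by
    intro h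
    rw [eq_neg_of_add_eq_zero_left h] at hvc
    exact hc0 (hι (by rw [map_zero]; linear_combination hvc))
  have hvω : v ^ 2 + v + 1 ≠ 0 := by
    intro h
    have : v * (ι c - 1) = 0 := by linear_combination h - hvc
    rcases mul_eq_zero.1 this with h | h
    · exact hv0 h
    · exact hc1 (hι (by rw [map_one]; linear_combination h))
  have hvsq : v ^ 2 ≠ 1 := fun h => by
    rcases mul_eq_zero.1 (show (v - 1) * (v + 1) = 0 by linear_combination h) with h | h
    exacts [hv1 h, hvn1 h]
  obtain ⟨m, hm, hm3, hmp⟩ : ∃ m : ℤ, (m = p ∧ p = 3 * (p / 3) + 1 ∨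
      m = -p ∧ p = 3 * (p / 3) + 2) ∧ m % 3 = 1 ∧ (m = p ∨ m = -p) := by
    rcases prime_eq_three_mul_div_add hp hp3 with h | h
    · exact ⟨p, .inl ⟨rfl, h⟩, by omega, .inl rfl⟩
    · exact ⟨-p, .inr ⟨rfl, h⟩, by omega, .inr rfl⟩
  have hne : ∀ x : K, x ^ 3 = v → x ≠ 0 := by
    rintro x hx rfl
    exact hv0 (by simpa using hx.symm)
  have hroot : ∀ q : ZMod p, q ^ 3 - 3 * q = c - 2 ↔ ∃ x : K, x ^ 3 = v ∧ x + x⁻¹ = ι q := by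
    intro q
    rw [← depressed_cubic_iff hv0, hv, ← hι.eq_iff]
    simp only [map_sub, map_mul, map_pow]
    rw [map_ofNat, map_ofNat]
  have hsum : ∀ b : K, b ^ 3 = v → ι S * (v + 1) * b ^ m = b * ((b ^ m) ^ 2 * b + 1) := by
    intro b hb
    have h := choose_sum_mul_zpow (hne b hb) (X := ι c - 4)
      (by rw [hb]; linear_combination -hvc) hm
    rw [hb] at h
    rw [← h, hS, map_sum]
    simp only [map_mul, map_pow, map_natCast, map_sub]
    rw [map_ofNat]
  have hnot : S = 1 → c * S ^ 3 ≠ 3 * S + 1 := by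
    rintro rfl h
    exact hc4 (by linear_combination h)
  -- Since `m ≡ 1 (mod 3)`, `w^m = w`, so `x^m / x` is the same for all cube roots `x` of `v`.
  have hratio : ∀ x y : K, x ^ 3 = v → y ^ 3 = v →
      ∃ w : K, w ^ 3 = 1 ∧ x = w * y ∧ x ^ m = w * y ^ m := by
    intro x y hx hy
    have hy0 := hne y hy
    have hw : (x / y) ^ 3 = 1 := by rw [div_pow, hx, hy, div_self hv0]
    refine ⟨x / y, hw, by field_simp, ?_⟩
    rw [← zpow_eq_self_of_pow_three_eq_one hm3 hw, ← mul_zpow, div_mul_cancel₀ _ hy0]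
  obtain ⟨b, hb⟩ := IsAlgClosed.exists_pow_nat_eq v (n := 3) (by norm_num)
  have hb0 := hne b hb
  obtain ⟨q₀, hq₀⟩ : ∃ d : ZMod p, ι d = v + v⁻¹ := ⟨c - 2, by rw [hv, map_sub, map_ofNat]⟩
  have hvm := (add_inv_mem_range_iff ι hmp hv0).1 ⟨q₀, hq₀⟩
  have hbm3 : (b ^ m) ^ 3 = v ^ m := by
    rw [← hb, ← zpow_natCast, ← zpow_natCast, ← zpow_mul, ← zpow_mul, mul_comm]
  rcases hvm with hvm | hvm
  · obtain ⟨w, hw, hbw, -⟩ := hratio (b ^ m) b (hbm3.trans hvm) hb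
    have hall : ∀ x : K, x ^ 3 = v → x ^ m = w * x := by
      intro x hx
      obtain ⟨u, -, h1, h2⟩ := hratio x b hx hb
      rw [h2, hbw, h1]; ring
    have hS' : ι S * (v + 1) * w = w ^ 2 * v + 1 := by
      have h := hsum b hb
      rw [hbw] at h
      apply mul_right_cancel₀ hb0
      linear_combination h + b * w ^ 2 * hb
    have hmem : ∀ x : K, x ^ 3 = v → ((∃ q : ZMod p, ι q = x + x⁻¹) ↔ w = 1) := by
      intro x hx
      have hx0 := hne x hx
      rw [add_inv_mem_range_iff ι hmp hx0, hall x hx]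
      constructor
      · rintro (h | h)
        · exact mul_right_cancel₀ hx0 (by rw [h, one_mul])
        · refine absurd ?_ hvsq
          have : (w * x * x) ^ 3 = 1 := by rw [h, one_pow]
          rw [← hx]
          linear_combination this - x ^ 6 * hw
      · rintro rfl
        simp
    by_cases hw1 : w = 1
    · have hS1 : S = 1 := by
        refine hι (mul_right_cancel₀ hvn1 ?_)
        rw [hw1] at hS'
        rw [map_one]
        linear_combination hS'
      refine .inr (.inl ⟨?_, hS1, hnot hS1⟩)
      obtain ⟨ω, hω0, hω⟩ := exists_add_inv_eq (-1 : K)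
      have hω2 : ω ^ 2 + ω + 1 = 0 := by
        field_simp at hω
        linear_combination hω
      have hω3 : ω ^ 3 = 1 := by linear_combination (ω - 1) * hω2
      have hω1 : ω ≠ 1 := by
        rintro rfl
        exact h3K (by linear_combination hω2)
      have hb1 : (ω * b) ^ 3 = v := by rw [mul_pow, hω3, hb, one_mul]
      have hb2 : (ω ^ 2 * b) ^ 3 = v := by
        linear_combination (ω ^ 3 + 1) * b ^ 3 * hω3 + hb
      obtain ⟨r₀, h₀⟩ := (hmem b hb).2 hw1
      obtain ⟨r₁, h₁⟩ := (hmem _ hb1).2 hw1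
      obtain ⟨r₂, h₂⟩ := (hmem _ hb2).2 hw1
      have hdist : ∀ x y : K, ∀ r s : ZMod p, x ^ 3 = v → y ^ 3 = v → ι r = x + x⁻¹ →
          ι s = y + y⁻¹ → x ≠ y → r ≠ s := by
        rintro x y r s hx hy hr hs hxy rfl
        rcases (add_inv_eq_add_inv_iff (hne x hx) (hne y hy)).1 (hr.symm.trans hs) with h | h
        · exact hxy h
        · refine hvsq ?_
          rw [sq]
          nth_rewrite 1 [← hx]
          rw [← hy, ← mul_pow, h, one_pow]
      rw [card_eq_three]
      refine ⟨r₀, r₁, r₂, hdist _ _ _ _ hb hb1 h₀ h₁ ?_, hdist _ _ _ _ hb hb2 h₀ h₂ ?_,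
        hdist _ _ _ _ hb1 hb2 h₁ h₂ ?_, ?_⟩
      · intro h
        exact hω1 (mul_right_cancel₀ hb0 (by rw [one_mul, ← h]))
      · intro h
        have h' : ω ^ 2 = 1 := mul_right_cancel₀ hb0 (by rw [one_mul, ← h])
        exact hω1 (by linear_combination hω3 - ω * h')
      · intro h
        have h' : ω = ω ^ 2 := mul_right_cancel₀ hb0 h
        exact hω1 (by linear_combination hω3 + (ω + 1) * h')
      · ext q
        rw [mem_filter_univ, hroot]
        simp only [mem_insert, mem_singleton]
        constructor
        · rintro ⟨x, hx, hxq⟩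
          obtain ⟨u, hu, hxu, -⟩ := hratio x b hx hb
          have : (u - 1) * ((u - ω) * (u - ω ^ 2)) = 0 := by
            linear_combination hu + (u - u ^ 2) * hω2 + (u - 1) * hω3
          rcases mul_eq_zero.1 this with h | h
          · refine .inl (hι ?_)
            rw [h₀, ← hxq, hxu, sub_eq_zero.1 h, one_mul]
          rcases mul_eq_zero.1 h with h | h
          · refine .inr (.inl (hι ?_))
            rw [h₁, ← hxq, hxu, sub_eq_zero.1 h]
          · refine .inr (.inr (hι ?_))
            rw [h₂, ← hxq, hxu, sub_eq_zero.1 h]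
        · rintro (rfl | rfl | rfl)
          exacts [⟨_, hb, h₀.symm⟩, ⟨_, hb1, h₁.symm⟩, ⟨_, hb2, h₂.symm⟩]
    · refine .inr (.inr ⟨?_, ?_, ?_⟩)
      · rw [card_eq_zero, filter_eq_empty_iff]
        intro q _ hq
        obtain ⟨x, hx, hxq⟩ := (hroot q).1 hq
        exact hw1 ((hmem x hx).1 ⟨q, hxq.symm⟩)
      · rintro rfl
        rw [map_one] at hS'
        rcases mul_eq_zero.1 (show (w - 1) * (w * v - 1) = 0 by linear_combination -hS')
          with h | h
        · exact hw1 (sub_eq_zero.1 h)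
        · have : (v - 1) * (v ^ 2 + v + 1) = 0 := by
            linear_combination (w ^ 2 * v ^ 2 + w * v + 1) * h - v ^ 3 * hw
          exact (mul_ne_zero hv1 hvω) this
      · intro h
        have h' : ι c * ι S ^ 3 = 3 * ι S + 1 := by
          have := congrArg ι h
          simp only [map_mul, map_pow, map_add, map_one] at this
          rwa [map_ofNat] at this
        have hcv : ι c * v = (v + 1) ^ 2 := by linear_combination -hvc
        have hS3 : (v + 1) ^ 2 * (ι S) ^ 3 = v * (3 * ι S + 1) := by
          linear_combination v * h' - ι S ^ 3 * hcv
        set s := ι S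
        -- Multiply `hS3` by `w³(v+1)` and insert `s(v+1)w = w²v + 1`; with `w³ = 1` what remains is
        -- `v³ + 1 - v(v+1)`.
        have e : (v - 1) ^ 2 * (v + 1) = 0 := by
          linear_combination w ^ 3 * (v + 1) * hS3 - ((s * (v + 1) * w) ^ 2 +
            s * (v + 1) * w * (w ^ 2 * v + 1) + (w ^ 2 * v + 1) ^ 2 - 3 * v * w ^ 2) * hS' +
            v * (v + 1) * hw - v ^ 3 * (w ^ 3 + 1) * hw
        exact mul_ne_zero (pow_ne_zero 2 hv1) hvn1 e
  · have hprod : ((b ^ m) * b) ^ 3 = 1 := by rw [mul_pow, hbm3, hb, hvm]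
    set w := b ^ m * b with hw
    -- The cube root inverted by `m`: `a^m a = w² b^m b = w³ = 1`.
    set a := w * b with ha
    have ha3 : a ^ 3 = v := by rw [ha, mul_pow, hprod, hb, one_mul]
    have ha0 := hne a ha3
    have ham : a ^ m = a⁻¹ := by
      have : a ^ m = w * b ^ m := by
        rw [ha, mul_zpow, zpow_eq_self_of_pow_three_eq_one hm3 hprod]
      rw [this]
      apply eq_inv_of_mul_eq_one_left
      rw [ha]
      linear_combination hprod - w ^ 2 * hw
    have hS' : ι S * (v + 1) = a * (a + 1) := by
      have h := hsum a ha3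
      rw [ham] at h
      field_simp at h
      linear_combination h
    have hroot_S : c * S ^ 3 = 3 * S + 1 := by
      apply hι
      simp only [map_mul, map_pow, map_add, map_ofNat, map_one]
      have ha1 : a + 1 ≠ 0 := by
        intro h
        exact hvn1 (by rw [← ha3]; linear_combination (a ^ 2 - a + 1) * h)
      -- That is, `S = 1/(q-1)` for `q = a + a⁻¹`.
      have hd : ι S * (a ^ 2 - a + 1) = a := by
        apply mul_right_cancel₀ ha1
        rw [← hS', ← ha3]
        ring
      have hcv : ι c * v = (v + 1) ^ 2 := by linear_combination -hvc
      apply mul_right_cancel₀ hv0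
      rw [← ha3] at hcv ⊢
      linear_combination ι S ^ 3 * hcv +
        ((a + 1) ^ 2 * ι S * (ι S * (a ^ 2 - a + 1) + a) + a ^ 2) * hd
    refine .inl ⟨?_, fun h => hnot h hroot_S, hroot_S⟩
    obtain ⟨r, hr⟩ := (add_inv_mem_range_iff ι hmp ha0).2 (.inr (by rw [ham, inv_mul_cancel₀ ha0]))
    rw [card_eq_one]
    refine ⟨r, ?_⟩
    ext q
    rw [mem_filter_univ, hroot, mem_singleton]
    constructor
    · rintro ⟨x, hx, hxq⟩
      obtain ⟨u, hu, hxu, hxm⟩ := hratio x a hx ha3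
      have hx0 := hne x hx
      have hu0 : u ≠ 0 := by rintro rfl; simp at hu
      rw [ham] at hxm
      rcases (add_inv_mem_range_iff ι hmp hx0).1 ⟨q, hxq.symm⟩ with h | h
      · refine absurd ?_ hvsq
        rw [hxm, hxu] at h
        have h' : a * a = 1 := by
          have := mul_left_cancel₀ hu0 h
          nth_rewrite 1 [← this]
          exact inv_mul_cancel₀ ha0
        rw [← ha3]
        linear_combination (a ^ 4 + a ^ 2 + 1) * h'
      · rw [hxm, hxu] at h
        have h' : u ^ 2 = 1 := by
          rw [← h]; field_simp
        have hu1 : u = 1 := by linear_combination hu - u * h'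
        refine hι (hxq.symm.trans ?_)
        rw [hr, hxu, hu1, one_mul]
    · rintro rfl
      exact ⟨a, ha3, hr.symm⟩

/-! ### Reduction of `p`-integral rationals modulo `p` -/

/-- The rational number `a` is `p`-integral with residue `α`. -/
def ReducesTo (p : ℕ) [Fact p.Prime] (a : ℚ) (α : ZMod p) : Prop :=
  (a.den : ZMod p) ≠ 0 ∧ (a : ZMod p) = α

theorem mem_pIntegralRat_iff {p : ℕ} {a : ℚ} : a ∈ pIntegralRat p ↔ (a.den : ZMod p) ≠ 0 := by
  rw [pIntegralRat, Set.mem_ofPred_eq, Ne, ZMod.natCast_eq_zero_iff]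

namespace ReducesTo

variable {p : ℕ} [hp : Fact p.Prime] {a b : ℚ} {α β : ZMod p}

theorem natCast (n : ℕ) : ReducesTo p n n := by
  constructor
  · simp
  · simp

theorem ofNat (n : ℕ) [n.AtLeastTwo] : ReducesTo p (OfNat.ofNat n) (OfNat.ofNat n) := by
  exact_mod_cast natCast (p := p) n

theorem one : ReducesTo p 1 1 := by exact_mod_cast natCast (p := p) 1

theorem zero : ReducesTo p 0 0 := by exact_mod_cast natCast (p := p) 0

theorem den_ne_zero_of_dvd {d : ℕ} (h : (d : ZMod p) ≠ 0) {e : ℕ} (hd : e ∣ d) :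
    (e : ZMod p) ≠ 0 := by
  rintro he
  obtain ⟨k, rfl⟩ := hd
  exact h (by rw [Nat.cast_mul, he, zero_mul])

theorem add (ha : ReducesTo p a α) (hb : ReducesTo p b β) : ReducesTo p (a + b) (α + β) := by
  refine ⟨den_ne_zero_of_dvd ?_ (Rat.add_den_dvd a b), ?_⟩
  · rw [Nat.cast_mul]; exact mul_ne_zero ha.1 hb.1
  · rw [Rat.cast_add_of_ne_zero ha.1 hb.1, ha.2, hb.2]

theorem mul (ha : ReducesTo p a α) (hb : ReducesTo p b β) : ReducesTo p (a * b) (α * β) := by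
  refine ⟨den_ne_zero_of_dvd ?_ (Rat.mul_den_dvd a b), ?_⟩
  · rw [Nat.cast_mul]; exact mul_ne_zero ha.1 hb.1
  · rw [Rat.cast_mul_of_ne_zero ha.1 hb.1, ha.2, hb.2]

theorem neg (ha : ReducesTo p a α) : ReducesTo p (-a) (-α) := by
  refine ⟨by simpa using ha.1, ?_⟩
  rw [Rat.cast_neg, ha.2]

theorem sub (ha : ReducesTo p a α) (hb : ReducesTo p b β) : ReducesTo p (a - b) (α - β) := by
  rw [sub_eq_add_neg, sub_eq_add_neg]
  exact ha.add hb.neg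

theorem pow (ha : ReducesTo p a α) (n : ℕ) : ReducesTo p (a ^ n) (α ^ n) := by
  induction n with
  | zero => simpa using one
  | succ n ih => rw [pow_succ, pow_succ]; exact ih.mul ha

theorem sum {ι : Type*} (s : Finset ι) {f : ι → ℚ} {g : ι → ZMod p}
    (h : ∀ i, ReducesTo p (f i) (g i)) : ReducesTo p (∑ i ∈ s, f i) (∑ i ∈ s, g i) := by
  classical
  induction s using Finset.induction_on with
  | empty => simpa using zero
  | insert i s hi ih => rw [sum_insert hi, sum_insert hi]; exact (h i).add ih

theorem num_ne_zero (ha : ReducesTo p a α) (hα : α ≠ 0) : (a.num : ZMod p) ≠ 0 := by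
  intro h
  apply hα
  rw [← ha.2, Rat.cast_def, h, zero_div]

theorem inv (ha : ReducesTo p a α) (hα : α ≠ 0) : ReducesTo p a⁻¹ α⁻¹ := by
  have hn := ha.num_ne_zero hα
  refine ⟨?_, by rw [Rat.cast_inv_of_ne_zero hn, ha.2]⟩
  have h0 : a ≠ 0 := by
    rintro rfl
    simp at hn
  rwa [Rat.den_inv_of_ne_zero h0, Ne, ZMod.natCast_eq_zero_iff, ← Int.natCast_dvd,
    ← ZMod.intCast_zmod_eq_zero_iff_dvd]

theorem div (ha : ReducesTo p a α) (hb : ReducesTo p b β) (hβ : β ≠ 0) :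
    ReducesTo p (a / b) (α / β) := by
  rw [div_eq_mul_inv, div_eq_mul_inv]
  exact ha.mul (hb.inv hβ)

theorem of_mem (ha : a ∈ pIntegralRat p) : ReducesTo p a (a : ZMod p) :=
  ⟨mem_pIntegralRat_iff.1 ha, rfl⟩

theorem ratModEq_zero_iff (ha : ReducesTo p a α) : RatModEq p a 0 ↔ α = 0 := by
  constructor
  · rintro ⟨c, hc, h⟩
    rw [sub_zero] at h
    rw [← ha.2, h, ((natCast p).mul (of_mem hc)).2, ZMod.natCast_self, zero_mul]
  · intro h
    have h1 := ha.2
    rw [h, Rat.cast_def, div_eq_zero_iff, or_iff_left ha.1, ZMod.intCast_zmod_eq_zero_iff_dvd] at h1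
    obtain ⟨k, hk⟩ := h1
    refine ⟨k / a.den, ?_, ?_⟩
    · have h2 := (natCast (p := p) a.den).inv ha.1
      have h3 : ReducesTo p (k : ℚ) (k : ZMod p) := ⟨by simp, by simp⟩
      rw [mem_pIntegralRat_iff, div_eq_mul_inv]
      exact (h3.mul h2).1
    · rw [sub_zero]
      nth_rewrite 1 [← Rat.num_div_den a]
      rw [hk]
      push_cast
      ring

end ReducesTo

/-! ### Transfer to the original cubic -/

theorem numSolutionsMod_monicCubic {p : ℕ} [Fact p.Prime] {a₁ a₂ a₃ : ℚ} {α₁ α₂ α₃ : ZMod p}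
    (h₁ : ReducesTo p a₁ α₁) (h₂ : ReducesTo p a₂ α₂) (h₃ : ReducesTo p a₃ α₃) :
    numSolutionsMod p (monicCubic a₁ a₂ a₃) =
      #{x : ZMod p | x ^ 3 + α₁ * x ^ 2 + α₂ * x + α₃ = 0} := by
  have hred : ∀ x : ℕ, RatModEq p ((monicCubic a₁ a₂ a₃).eval (x : ℚ)) 0 ↔
      (x : ZMod p) ^ 3 + α₁ * (x : ZMod p) ^ 2 + α₂ * x + α₃ = 0 := by
    intro x
    have hx : ReducesTo p (x : ℚ) (x : ZMod p) := .natCast x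
    rw [← ((((hx.pow 3).add (h₁.mul (hx.pow 2))).add (h₂.mul hx)).add h₃).ratModEq_zero_iff]
    simp [monicCubic]
  classical
  rw [numSolutionsMod]
  refine card_nbij' (fun x => (x : ZMod p)) ZMod.val ?_ ?_ ?_ ?_
  · intro x hx
    simpa [hred] using (mem_filter.1 hx).2
  · intro x hx
    simp only [coe_filter, Set.mem_ofPred_eq, mem_univ, true_and] at hx
    simp [hred, ZMod.val_lt, hx]
  · intro x hx
    exact ZMod.val_cast_of_lt (mem_range.1 (mem_filter.1 hx).1)
  · intro x _
    exact ZMod.natCast_zmod_val x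

/-- The substitution `x = (P / A) z / 3 - α₁ / 3`. -/
theorem cubic_substitution {F : Type*} [Field F] {α₁ α₂ α₃ A P : F} (h3 : (3 : F) ≠ 0)
    (hA : A = α₁ ^ 2 - 3 * α₂) (hP : P = -2 * α₁ ^ 3 + 9 * α₁ * α₂ - 27 * α₃) (hA0 : A ≠ 0)
    (hP0 : P ≠ 0) (z : F) :
    (P / (3 * A) * z - α₁ / 3) ^ 3 + α₁ * (P / (3 * A) * z - α₁ / 3) ^ 2 +
        α₂ * (P / (3 * A) * z - α₁ / 3) + α₃ = 0 ↔ P ^ 2 / A ^ 3 * z ^ 3 = 3 * z + 1 := by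
  have key : 27 * ((P / (3 * A) * z - α₁ / 3) ^ 3 + α₁ * (P / (3 * A) * z - α₁ / 3) ^ 2 +
        α₂ * (P / (3 * A) * z - α₁ / 3) + α₃) = P * (P ^ 2 / A ^ 3 * z ^ 3 - (3 * z + 1)) := by
    -- `y = 3x + α₁` completes the cube, giving `y³ - 3Ay - P`.
    obtain ⟨y, hy⟩ : ∃ y, y = P / A * z := ⟨_, rfl⟩
    have e1 : P / (3 * A) * z - α₁ / 3 = (y - α₁) / 3 := by rw [hy]; field_simp
    have e2 : P * (P ^ 2 / A ^ 3 * z ^ 3 - (3 * z + 1)) = y ^ 3 - 3 * A * y - P := by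
      rw [hy]; field_simp; ring
    rw [e1, e2, hA, hP]
    field_simp
    ring
  have h27 : (27 : F) ≠ 0 := by
    rw [show (27 : F) = 3 ^ 3 by norm_num]
    exact pow_ne_zero 3 h3
  rw [← sub_eq_zero (b := 3 * z + 1), ← mul_right_inj' h27, key, mul_zero, mul_eq_zero,
    or_iff_right hP0]

/-- The bijection is `q = 1 + z⁻¹`: `z = 0` never solves `c z³ = 3z + 1`, and `q = 1` would force `c
= 0`. -/
theorem card_cubic_roots {F : Type*} [Field F] [Fintype F] [DecidableEq F] {α₁ α₂ α₃ A P c : F}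
    (h3 : (3 : F) ≠ 0) (hA : A = α₁ ^ 2 - 3 * α₂)
    (hP : P = -2 * α₁ ^ 3 + 9 * α₁ * α₂ - 27 * α₃) (hA0 : A ≠ 0) (hP0 : P ≠ 0)
    (hc : c = P ^ 2 / A ^ 3) :
    #{x : F | x ^ 3 + α₁ * x ^ 2 + α₂ * x + α₃ = 0} = #{q : F | q ^ 3 - 3 * q = c - 2} := by
  have hc0 : c ≠ 0 := by rw [hc]; positivity
  have hsub := cubic_substitution h3 hA hP hA0 hP0
  rw [← hc] at hsub
  have hinv : ∀ x, P / (3 * A) * ((3 * x + α₁) * A / P) - α₁ / 3 = x := fun x => by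
    field_simp
    ring
  have hz : ∀ x, x ^ 3 + α₁ * x ^ 2 + α₂ * x + α₃ = 0 →
      c * ((3 * x + α₁) * A / P) ^ 3 = 3 * ((3 * x + α₁) * A / P) + 1 := by
    intro x hx
    rw [← hsub, hinv, hx]
  refine card_nbij' (fun x => 1 + ((3 * x + α₁) * A / P)⁻¹)
    (fun q => P / (3 * A) * (q - 1)⁻¹ - α₁ / 3) ?_ ?_ ?_ ?_
  · intro x hx
    rw [mem_coe, mem_filter_univ] at hx ⊢
    have h := hz x hx
    beta_reduce
    generalize (3 * x + α₁) * A / P = z at h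
    have hz0 : z ≠ 0 := by rintro rfl; simp at h
    field_simp
    linear_combination -h
  · intro q hq
    rw [mem_coe, mem_filter_univ] at hq ⊢
    have hq1 : q - 1 ≠ 0 := by
      intro h
      rw [sub_eq_zero.1 h] at hq
      exact hc0 (by linear_combination -hq)
    rw [hsub]
    field_simp
    linear_combination -hq
  · intro x hx
    simp only [add_sub_cancel_left, inv_inv]
    exact hinv x
  · intro q hq
    simp only
    have : (3 * (P / (3 * A) * (q - 1)⁻¹ - α₁ / 3) + α₁) * A / P = (q - 1)⁻¹ := by
      have e : 3 * (P / (3 * A) * (q - 1)⁻¹ - α₁ / 3) + α₁ = P / A * (q - 1)⁻¹ := by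
        rw [mul_sub, mul_div_cancel₀ _ h3, sub_add_cancel, ← mul_assoc]
        congr 1
        field_simp
      rw [e]
      field_simp
    rw [this, inv_inv]
    ring

theorem theorem2p2 (p : ℕ) (hp : p.Prime) (hp3 : 3 < p) (a₁ a₂ a₃ : ℚ)
    (h₁ : a₁ ∈ pIntegralRat p) (h₂ : a₂ ∈ pIntegralRat p) (h₃ : a₃ ∈ pIntegralRat p)
    (P Q : ℚ) (hP : P = -2 * a₁ ^ 3 + 9 * a₁ * a₂ - 27 * a₃)
    (hQ : Q = (a₁ ^ 2 - 3 * a₂) ^ 3)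
    (hPQ : ¬ RatModEq p (P * Q * (P ^ 2 - Q) * (P ^ 2 - 3 * Q) * (P ^ 2 - 4 * Q)) 0) :
    (numSolutionsMod p (monicCubic a₁ a₂ a₃) = 3 ↔
      RatModEq p
        (∑ k ∈ Finset.Icc 1 (p / 3),
          ((3 * k).choose k : ℚ) * ((4 * Q - P ^ 2) / (27 * Q)) ^ k) 0) ∧
    (numSolutionsMod p (monicCubic a₁ a₂ a₃) = 1 ↔
      RatModEq p
        ((monicCubic a₁ a₂ a₃).eval
          (P / (3 * (a₁ ^ 2 - 3 * a₂)) *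
              ∑ k ∈ Finset.Icc 0 (p / 3),
                ((3 * k).choose k : ℚ) * ((4 * Q - P ^ 2) / (27 * Q)) ^ k
            - a₁ / 3)) 0) := by
  have : Fact p.Prime := ⟨hp⟩
  have h3 : (3 : ZMod p) ≠ 0 := by
    have : ((3 : ℕ) : ZMod p) ≠ 0 := by
      rw [Ne, ZMod.natCast_eq_zero_iff]
      exact fun h => absurd (Nat.le_of_dvd (by omega) h) (by omega)
    exact_mod_cast this
  have h27 : (27 : ZMod p) ≠ 0 := by
    rw [show (27 : ZMod p) = 3 ^ 3 by norm_num]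
    exact pow_ne_zero 3 h3
  have r₁ := ReducesTo.of_mem h₁
  have r₂ := ReducesTo.of_mem h₂
  have r₃ := ReducesTo.of_mem h₃
  generalize (a₁ : ZMod p) = α₁ at r₁
  generalize (a₂ : ZMod p) = α₂ at r₂
  generalize (a₃ : ZMod p) = α₃ at r₃
  have rA : ReducesTo p (a₁ ^ 2 - 3 * a₂) (α₁ ^ 2 - 3 * α₂) :=
    (r₁.pow 2).sub ((ReducesTo.ofNat 3).mul r₂)
  have rP : ReducesTo p P (-2 * α₁ ^ 3 + 9 * α₁ * α₂ - 27 * α₃) := by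
    rw [hP]
    exact (((ReducesTo.ofNat 2).neg.mul (r₁.pow 3)).add (((ReducesTo.ofNat 9).mul r₁).mul r₂)).sub
      ((ReducesTo.ofNat 27).mul r₃)
  obtain ⟨A, hA⟩ : ∃ A, A = α₁ ^ 2 - 3 * α₂ := ⟨_, rfl⟩
  obtain ⟨R, hR⟩ : ∃ R, R = -2 * α₁ ^ 3 + 9 * α₁ * α₂ - 27 * α₃ := ⟨_, rfl⟩
  rw [← hA] at rA
  rw [← hR] at rP
  have rQ : ReducesTo p Q (A ^ 3) := by rw [hQ]; exact rA.pow 3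
  have r4Q := (ReducesTo.ofNat (p := p) 4).mul rQ
  rw [((((rP.mul rQ).mul ((rP.pow 2).sub rQ)).mul ((rP.pow 2).sub
    ((ReducesTo.ofNat 3).mul rQ))).mul ((rP.pow 2).sub r4Q)).ratModEq_zero_iff] at hPQ
  simp only [mul_eq_zero, not_or] at hPQ
  obtain ⟨⟨⟨⟨hR0, hA3⟩, hn1⟩, -⟩, hn4⟩ := hPQ
  have hA0 : A ≠ 0 := by rintro rfl; simp at hA3
  obtain ⟨c, hc⟩ : ∃ c, c = R ^ 2 / A ^ 3 := ⟨_, rfl⟩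
  have hcA : c * A ^ 3 = R ^ 2 := by rw [hc, div_mul_cancel₀ _ hA3]
  have hc0 : c ≠ 0 := by rw [hc]; exact div_ne_zero (pow_ne_zero 2 hR0) hA3
  have hc1 : c ≠ 1 := by
    rintro rfl
    exact hn1 (by linear_combination -hcA)
  have hc4 : c ≠ 4 := by
    rintro rfl
    exact hn4 (by linear_combination -hcA)
  obtain ⟨t, ht⟩ : ∃ t, t = (4 * A ^ 3 - R ^ 2) / (27 * A ^ 3) := ⟨_, rfl⟩
  have rt : ReducesTo p ((4 * Q - P ^ 2) / (27 * Q)) t := by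
    rw [ht]
    exact (r4Q.sub (rP.pow 2)).div ((ReducesTo.ofNat 27).mul rQ) (mul_ne_zero h27 hA3)
  have htc : -27 * t = c - 4 := by
    rw [ht, ← hcA]
    field_simp
    ring
  have rterm (k : ℕ) : ReducesTo p (((3 * k).choose k : ℚ) * ((4 * Q - P ^ 2) / (27 * Q)) ^ k)
      (((3 * k).choose k : ZMod p) * t ^ k) := (ReducesTo.natCast _).mul (rt.pow k)
  obtain ⟨S, hS⟩ : ∃ S, S = ∑ k ∈ range (p / 3 + 1), ((3 * k).choose k : ZMod p) * t ^ k :=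
    ⟨_, rfl⟩
  have rS₀ := ReducesTo.sum (Icc 0 (p / 3)) rterm
  have rS₁ := ReducesTo.sum (Icc 1 (p / 3)) rterm
  have hS₀ : ∑ k ∈ Icc 0 (p / 3), ((3 * k).choose k : ZMod p) * t ^ k = S := by
    rw [hS, range_eq_Ico]
    rfl
  -- The `k = 0` term is `1`, so the sum in (i) vanishes exactly when `S = 1`.
  have hS₁ : 1 + ∑ k ∈ Icc 1 (p / 3), ((3 * k).choose k : ZMod p) * t ^ k = S := by
    rw [← hS₀, ← add_sum_Ioc_eq_sum_Icc (Nat.zero_le _)]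
    simp
    rfl
  rw [hS₀] at rS₀
  have rx := ((rP.div ((ReducesTo.ofNat 3).mul rA) (mul_ne_zero h3 hA0)).mul rS₀).sub
    (r₁.div (ReducesTo.ofNat 3) h3)
  have rf := (((rx.pow 3).add (r₁.mul (rx.pow 2))).add (r₂.mul rx)).add r₃
  have heval (x : ℚ) : (monicCubic a₁ a₂ a₃).eval x = x ^ 3 + a₁ * x ^ 2 + a₂ * x + a₃ := by
    simp [monicCubic]
  rw [heval, rf.ratModEq_zero_iff, rS₁.ratModEq_zero_iff,
    cubic_substitution h3 hA hR hA0 hR0, ← hc, numSolutionsMod_monicCubic r₁ r₂ r₃,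
    card_cubic_roots h3 hA hR hA0 hR0 hc]
  have hS1 : ∑ k ∈ Icc 1 (p / 3), ((3 * k).choose k : ZMod p) * t ^ k = 0 ↔ S = 1 := by
    rw [← hS₁, add_eq_left]
  rw [hS1]
  rw [sum_choose_three_mul_zmod hp3, htc] at hS
  rcases card_roots_trichotomy hp3 hc0 hc1 hc4 hS with ⟨e, hx, hy⟩ | ⟨e, hx, hy⟩ | ⟨e, hx, hy⟩ <;>
    exact ⟨by simp [e, hx], by simp [e, hy]⟩
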